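/- Let $\mathbb O$ be the octonions with units $e_0,\dots,e_7$; for $x=\sum_{\ell=0}^{7} x^\ell e_\ell$ write $x^\ell\in\mathbb R$ for its coordinates. Consider the octonion-valued neural network (OVNN) with control $$\dot w_p(t)=-d_pw_p(t)+\sum_{q=1}^n a_{pq}f_q(w_q(t))+\sum_{q=1}^n b_{pq}g_q(w_q(t-\tau_{pq}(t)))+I_p+U_p(t),\qquad p=1,\dots,n,\ t\ge 0,$$ where $d_p>0$, $a_{pq},b_{pq},I_p\in\mathbb O$, $f_q,g_q:\mathbb O\to\mathbb O$, $\tau_{pq}(t)\ge 0$, with a continuous history on $(-\infty,0]$. Assume: (A1) the partial derivatives $\partial f_q^{\ell_1}/\partial w_q^{\ell_2}$ and $\partial g_q^{\ell_1}/\partial w_q^{\ell_2}$ exist, are continuous and satisfy $0\le \partial f_q^{\ell_1}/\partial w_q^{\ell_2}\le\lambda_q^{\ell_1\ell_2}$, $0\le \partial g_q^{\ell_1}/\partial w_q^{\ell_2}\le\delta_q^{\ell_1\ell_2}$ for some positive constants; (A2) there is a continuous function $\tau$ with $\tau_{pq}(t)\le\tau(t)$ for all $p,q$ and $t\ge0$,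 and $\tau(t)\to+\infty$, $t-\tau(t)\to+\infty$ as $t\to+\infty$; (A3) $\mu$ is nondecreasing and continuous on $[0,\infty)$, differentiable for all large $t$, with $\mu(t)\to+\infty$, $\dot\mu(t)/\mu(t)\to\alpha\ge0$ and $\mu(t)/\mu(t-\tau(t))\to1+\beta\ge1$ as $t\to+\infty$. Let $\hat z=(\hat z_1,\dots,\hat z_n)\in\mathbb O^n$ be any target, $\hat w_p=w_p-\hat z_p$, let $\Lambda_p[\ell]>0$ ($p=1,\dots,n$, $\ell=0,\dots,7$) be any weights, and put $$\|\hat Y(t)\|=\max_{\ell}\max_p\big|\Lambda_p[\ell]^{-1}\hat w_p^\ell(t)\big|,\qquad S(t)=\sup_{t-\tau(t)\le s\le t}\|\hat Y(s)\|.$$ Let $c_1,c_2,c_3>0$ be arbitrary and use the controller $$U_p^\ell(t)=-\mathrm{sign}(\hat w_p^\ell(t))\big(\kappa(t)|\hat w_p^\ell(t)|+\hat\kappa(t)\big)$$ with the adaptive rules $$\dot{\hat\kappa}(t)=\begin{cases}0,&S(t)>1,\\ c_1,&0<S(t)\le1,\\ 0,&S(t)=0,\end{cases}\qquad \dot\kappa(t)=\begin{cases}c_2\,\mu(t)\,\|\hat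 Y(t)\|,&S(t)>1,\\ c_3\,\|\hat Y(t)\|,&S(t)\le1,\end{cases}$$ and any initial values $\kappa(0),\hat\kappa(0)\in\mathbb R$, for instance $\kappa(0)=\hat\kappa(0)=0$. Solutions on $[0,\infty)$ are understood in the sense of Filippov with respect to the sign function: $w_p^\ell,\kappa,\hat\kappa$ are locally absolutely continuous on $[0,\infty)$ and the equations hold for almost every $t>0$, where $\mathrm{sign}(0)$ may be any value in $[-1,1]$. Then the adaptive finite-time stability is realized, that is: 1. every solution reaches the target in finite time: there is $T\ge0$ (depending on the solution) such that $w_p(t)=\hat z_p$ for all $p$ and all $t\ge T$; 2. if moreover $|\hat I_p^\ell|\le\hat\kappa(0)$ for all $p,\ell$, where $\hat I_p=I_p-d_p\hat z_p+\sum_{q=1}^n\big[a_{pq}f_q(\hat z_q)+b_{pq}g_q(\hat z_q)\big]$ (for zero initial gains: if $\hat z$ is an equilibrium of the uncontrolled network), then the target is Lyapunov stable: for every $\varepsilon>0$ there is $\delta>0$ such that every solution with these initial gains and with $\|\hat Y(s)\|<\delta$ for all $s\le0$ satisfies $\|\hat Y(t)\|<\varepsilon$ for all $t\ge0$. -/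

import Mathlib

open MeasureTheory Set Filter Topology

noncomputable section

/-- The underlying eight-dimensional real space of the octonions: `x i` is the coefficient of the
unit `e_i`. The octonion product is `OVNN.omul` (never the pointwise product of functions). -/
abbrev Octonion : Type := Fin 8 → ℝ

namespace OVNN

/-- `e_i * e_j = unitSign i j • e_(unitIdx i j)`: the index part of the multiplication table. -/
def unitIdx : Fin 8 → Fin 8 → Fin 8 :=
  ![![0, 1, 2, 3, 4, 5, 6, 7],
    ![1, 0, 3, 2, 5, 4, 7, 6],
    ![2, 3, 0, 1, 6, 7, 4, 5],
    ![3, 2, 1, 0, 7, 6, 5, 4],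
    ![4, 5, 6, 7, 0, 1, 2, 3],
    ![5, 4, 7, 6, 1, 0, 3, 2],
    ![6, 7, 4, 5, 2, 3, 0, 1],
    ![7, 6, 5, 4, 3, 2, 1, 0]]

/-- `e_i * e_j = unitSign i j • e_(unitIdx i j)`: the sign part of the multiplication table. -/
def unitSign : Fin 8 → Fin 8 → ℤ :=
  ![![1,  1,  1,  1,  1,  1,  1,  1],
    ![1, -1,  1, -1,  1, -1, -1,  1],
    ![1, -1, -1,  1,  1,  1, -1, -1],
    ![1,  1, -1, -1,  1, -1,  1, -1],
    ![1, -1, -1, -1, -1,  1,  1,  1],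
    ![1,  1, -1,  1, -1, -1, -1,  1],
    ![1,  1,  1, -1, -1,  1, -1, -1],
    ![1, -1,  1,  1, -1, -1,  1, -1]]

/-- The octonion product, extended bilinearly from the multiplication table of the units. -/
def omul (x y : Octonion) : Octonion := fun k =>
  ∑ i, ∑ j, if unitIdx i j = k then (unitSign i j : ℝ) * x i * y j else 0

/-- The data of a delayed octonion-valued neural network with `n` neurons:
`w_p'(t) = -d_p w_p(t) + ∑ q, a_pq f_q(w_q(t)) + ∑ q, b_pq g_q(w_q(t - τ_pq(t))) + I_p`. -/
structure Network (n : ℕ) where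
  /-- feedback self-connection weights -/
  d : Fin n → ℝ
  /-- connection weights without delay -/
  a : Fin n → Fin n → Octonion
  /-- connection weights with delay -/
  b : Fin n → Fin n → Octonion
  /-- activation functions without delay -/
  f : Fin n → Octonion → Octonion
  /-- activation functions with delay -/
  g : Fin n → Octonion → Octonion
  /-- transmission delays -/
  delay : Fin n → Fin n → ℝ → ℝ
  /-- external inputs -/
  input : Fin n → Octonion

variable {n : ℕ}

/-- The right-hand side of the (uncontrolled) network, along the trajectory `w`, at time `t`. -/
def Network.drift (N : Network n) (w : ℝ → Fin n → Octonion) (t : ℝ) (p : Fin n) : Octonion :=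
  -(N.d p • w t p) + ∑ q, omul (N.a p q) (N.f q (w t q))
    + ∑ q, omul (N.b p q) (N.g q (w (t - N.delay p q t) q)) + N.input p

/-- The residual input at the target `z`:
`I_p - d_p z_p + ∑ q, (a_pq f_q(z_q) + b_pq g_q(z_q))`. It vanishes for all `p` exactly when `z`
is an equilibrium of the uncontrolled network. -/
def Network.residual (N : Network n) (z : Fin n → Octonion) (p : Fin n) : Octonion :=
  N.input p - N.d p • z p
    + ∑ q, (omul (N.a p q) (N.f q (z q)) + omul (N.b p q) (N.g q (z q)))

/-- All partial derivatives of the components of `h_q : ℝ⁸ → ℝ⁸` exist, are continuous, and lie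
between `0` and positive constants `bd q ℓ₁ ℓ₂`. -/
def BoundedPartials (h : Fin n → Octonion → Octonion) : Prop :=
  ∃ bd : Fin n → Fin 8 → Fin 8 → ℝ, ∀ q l₁ l₂, 0 < bd q l₁ l₂ ∧
    (∀ x, LineDifferentiableAt ℝ (fun y => h q y l₁) x (Pi.single l₂ 1)) ∧
    Continuous (fun x => lineDeriv ℝ (fun y => h q y l₁) x (Pi.single l₂ 1)) ∧
    ∀ x, 0 ≤ lineDeriv ℝ (fun y => h q y l₁) x (Pi.single l₂ 1) ∧
      lineDeriv ℝ (fun y => h q y l₁) x (Pi.single l₂ 1) ≤ bd q l₁ l₂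

/-- The nonnegative delays are dominated on `[0, ∞)` by a continuous function `τ` such that
`τ(t) → ∞` and `t - τ(t) → ∞`. -/
structure DelayBound (N : Network n) (τ : ℝ → ℝ) : Prop where
  delay_nonneg : ∀ p q t, 0 ≤ t → 0 ≤ N.delay p q t
  delay_le : ∀ p q t, 0 ≤ t → N.delay p q t ≤ τ t
  cont : ContinuousOn τ (Ici 0)
  tendsto : Tendsto τ atTop atTop
  tendsto_sub : Tendsto (fun t => t - τ t) atTop atTop

/-- `μ` is a nondecreasing continuous function on `[0, ∞)` with `μ → ∞`, `μ' / μ → α ≥ 0` and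
`μ(t) / μ(t - τ(t)) → 1 + β ≥ 1`. -/
structure RateFunction (τ μ : ℝ → ℝ) : Prop where
  mono : MonotoneOn μ (Ici 0)
  cont : ContinuousOn μ (Ici 0)
  tendsto : Tendsto μ atTop atTop
  differentiable : ∀ᶠ t in atTop, DifferentiableAt ℝ μ t
  log_deriv : ∃ α : ℝ, 0 ≤ α ∧ Tendsto (fun t => deriv μ t / μ t) atTop (𝓝 α)
  ratio : ∃ β : ℝ, 0 ≤ β ∧ Tendsto (fun t => μ t / μ (t - τ t)) atTop (𝓝 (1 + β))

/-- The weighted maximum norm `max_ℓ max_p |Λ_p[ℓ]⁻¹ y_p^ℓ|`. -/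
def wnorm (Lam : Fin n → Fin 8 → ℝ) (y : Fin n → Octonion) : ℝ :=
  ⨆ l, ⨆ p, |(Lam p l)⁻¹ * y p l|

/-- The supremum of the error norm over the delay window `[t - τ(t), t]`. -/
def windowSup (Lam : Fin n → Fin 8 → ℝ) (z : Fin n → Octonion) (τ : ℝ → ℝ)
    (w : ℝ → Fin n → Octonion) (t : ℝ) : ℝ :=
  sSup ((fun s => wnorm Lam (w s - z)) '' Icc (t - τ t) t)

open scoped Classical in
/-- Adaptive rule for the constant gain: the rate as a function of the window supremum `S`. -/
def rateConst (c₁ S : ℝ) : ℝ :=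
  if S = 0 then 0 else if S ≤ 1 then c₁ else 0

open scoped Classical in
/-- Adaptive rule for the proportional gain: the rate as a function of `μ(t)`, of the window
supremum `S` and of the current error norm `y`. -/
def rateProp (c₂ c₃ m S y : ℝ) : ℝ :=
  if S ≤ 1 then c₃ * y else c₂ * m * y

/-- The set-valued sign: `{1}` for `x > 0`, `{-1}` for `x < 0`, `[-1, 1]` for `x = 0`. -/
def signSet (x : ℝ) : Set ℝ :=
  {s | s ∈ Icc (-1) 1 ∧ (0 < x → s = 1) ∧ (x < 0 → s = -1)}

/-- A function is locally absolutely continuous on `[0, ∞)`. -/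
def LocallyAC (x : ℝ → ℝ) : Prop :=
  ∀ T, 0 < T → AbsolutelyContinuousOnInterval x 0 T

/-- `(w, κ, κh)` is a (Filippov) solution on `[0, ∞)`, with continuous history on `(-∞, 0]`, of the
network under the controller `U_p^ℓ = -sign(ŵ_p^ℓ) (κ |ŵ_p^ℓ| + κh)`, `ŵ = w - z`, with the
adaptive rules for the gains, started at the gains `κ₀`, `κh₀`. -/
structure IsControlledSolution (N : Network n) (z : Fin n → Octonion) (Lam : Fin n → Fin 8 → ℝ)
    (τ μ : ℝ → ℝ) (c₁ c₂ c₃ κ₀ κh₀ : ℝ)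
    (w : ℝ → Fin n → Octonion) (κ κh : ℝ → ℝ) : Prop where
  history : Continuous w
  state_ac : ∀ p l, LocallyAC (fun t => w t p l)
  gain_ac : LocallyAC κ
  gainh_ac : LocallyAC κh
  gain_init : κ 0 = κ₀
  gainh_init : κh 0 = κh₀
  state_eq : ∀ p l, ∀ᵐ t ∂(volume.restrict (Ioi (0 : ℝ))),
    ∃ s ∈ signSet (w t p l - z p l),
      HasDerivAt (fun r => w r p l)
        (N.drift w t p l + -s * (κ t * |w t p l - z p l| + κh t)) t
  gainh_eq : ∀ᵐ t ∂(volume.restrict (Ioi (0 : ℝ))),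
    HasDerivAt κh (rateConst c₁ (windowSup Lam z τ w t)) t
  gain_eq : ∀ᵐ t ∂(volume.restrict (Ioi (0 : ℝ))),
    HasDerivAt κ (rateProp c₂ c₃ (μ t) (windowSup Lam z τ w t) (wnorm Lam (w t - z))) t

end OVNN

end

/-! With `y = w - z`, the sign controller gives, wherever `y_p^l` is nonzero, the growth rate `A R +
C - κh - κ |y_p^l|` as a bound for `|y_p^l|`. Here `R` bounds the error over the delay window, `A`
comes from the Lipschitz constants of the activations and `C` from the residual at the target. The
rest uses only this inequality and the adaptive rules.

Finite time. Once `μ ≥ 1`, `κ` grows at least in proportion to the error, so it diverges or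
converges. If it diverges, it dominates `A R + C` at late large record values, so the error is
bounded, and then small (`tendsto_zero_of_gain_tendsto`). If it converges, a large error, which
cannot have built up quickly, would persist long enough to add a fixed amount to `κ`
(`tendsto_zero_of_gain_cauchy`). Either way the error tends to zero and the window supremum is
eventually at most `1`. Now `κh` is monotone: if unbounded, it drives the error to exactly zero at
unit rate (`eq_zero_of_gainh_tendsto`). If bounded, the error is already zero, since a single
nonzero value stays in ever longer windows and would push `κh` beyond its bound
(`eq_target_of_gainh_le`).

Stability. The initial `κh` absorbs the residual. While the error is at most `e`, `κh` grows at rate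
`c₁` after the last zero of a component, which limits the excursion to the order of `e²`; for small
`e` the level `e` is never reached. -/

/-! ### Comparison lemmas for absolutely continuous functions -/

/-- An absolutely continuous function whose derivative is at most `k - c (t - a)` almost everywhere
grows by at most the integral of that bound. -/
theorem AbsolutelyContinuousOnInterval.sub_le_of_deriv_le {u : ℝ → ℝ} {a b k c : ℝ}
    (hu : AbsolutelyContinuousOnInterval u a b) (hab : a ≤ b)
    (h : ∀ᵐ t, t ∈ Ioo a b → ∃ D, HasDerivAt u D t ∧ D ≤ k - c * (t - a)) :
    u b - u a ≤ k * (b - a) - c * (b - a) ^ 2 / 2 := by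
  have hint : ∫ t in a..b, (k - c * (t - a)) = k * (b - a) - c * (b - a) ^ 2 / 2 := by
    have hd : ∀ t ∈ uIcc a b,
        HasDerivAt (fun t => k * (t - a) - c * (t - a) ^ 2 / 2) (k - c * (t - a)) t := by
      intro t _
      have h1 : HasDerivAt (fun t : ℝ => t - a) 1 t := (hasDerivAt_id t).sub_const a
      have h2 := (h1.const_mul k).sub (((h1.pow 2).const_mul c).div_const 2)
      exact h2.congr_deriv (by norm_num; ring)
    rw [intervalIntegral.integral_eq_sub_of_hasDerivAt hd
      (Continuous.intervalIntegrable (by fun_prop) _ _)]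
    simp
  rw [← hu.integral_deriv_eq_sub, ← hint]
  refine intervalIntegral.integral_mono_ae_restrict hab hu.intervalIntegrable_deriv
    (Continuous.intervalIntegrable (by fun_prop) _ _) ?_
  rw [Measure.restrict_congr_set Ioo_ae_eq_Icc.symm]
  refine (ae_restrict_iff' measurableSet_Ioo).2 ?_
  filter_upwards [h] with t ht htI
  obtain ⟨D, hD, hle⟩ := ht htI
  rwa [hD.deriv]

/-- A lower bound for the derivative almost everywhere bounds the increment from below. -/
theorem AbsolutelyContinuousOnInterval.le_sub_of_le_deriv {u : ℝ → ℝ} {a b k : ℝ}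
    (hu : AbsolutelyContinuousOnInterval u a b) (hab : a ≤ b)
    (h : ∀ᵐ t, t ∈ Ioo a b → ∃ D, HasDerivAt u D t ∧ k ≤ D) :
    k * (b - a) ≤ u b - u a := by
  have := (hu.neg).sub_le_of_deriv_le (k := -k) (c := 0) hab (by
    filter_upwards [h] with t ht htI
    obtain ⟨D, hD, hle⟩ := ht htI
    exact ⟨-D, hD.neg, by linarith⟩)
  simp only [Pi.neg_apply] at this
  linarith

/-- Comparison for `|u|` on an interval on which `u` does not vanish. -/
theorem AbsolutelyContinuousOnInterval.abs_le_of_ne_zero {u : ℝ → ℝ} {a b k c : ℝ}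
    (hu : AbsolutelyContinuousOnInterval u a b) (hab : a ≤ b)
    (hne : ∀ t ∈ Ioc a b, u t ≠ 0)
    (h : ∀ᵐ t, t ∈ Ioo a b → ∃ D, HasDerivAt u D t ∧ (0 < u t → D ≤ k - c * (t - a)) ∧
      (u t < 0 → -D ≤ k - c * (t - a))) :
    |u b| ≤ |u a| + k * (b - a) - c * (b - a) ^ 2 / 2 := by
  rcases hab.eq_or_lt with rfl | hlt
  · simp
  have hcont : ContinuousOn u (Icc a b) := by
    have := hu.continuousOn
    rwa [uIcc_of_le hab] at this
  have hpc : IsPreconnected (Ioc a b) := isPreconnected_Ioc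
  have hb : b ∈ Ioc a b := ⟨hlt, le_rfl⟩
  have hc' : ContinuousOn u (Ioc a b) := hcont.mono Ioc_subset_Icc_self
  -- By the intermediate value theorem `u` keeps the sign of `u b` on `Ioc a b`; `u a` itself may
  -- vanish, as when `a` is the last zero.
  rcases lt_or_gt_of_ne (hne b hb) with hneg | hpos
  · have hall : ∀ t ∈ Ioc a b, u t < 0 := by
      intro t ht
      by_contra hcon
      obtain ⟨s, hs, hs0⟩ := hpc.intermediate_value hb ht hc' ⟨hneg.le, not_lt.1 hcon⟩
      exact hne s hs hs0
    have := (hu.neg).sub_le_of_deriv_le (k := k) (c := c) hab (by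
      filter_upwards [h] with t ht htI
      obtain ⟨D, hD, _, h2⟩ := ht htI
      exact ⟨-D, hD.neg, h2 (hall t ⟨htI.1, htI.2.le⟩)⟩)
    simp only [Pi.neg_apply] at this
    rw [abs_of_neg hneg]
    linarith [neg_abs_le (u a)]
  · have hall : ∀ t ∈ Ioc a b, 0 < u t := by
      intro t ht
      by_contra hcon
      obtain ⟨s, hs, hs0⟩ := hpc.intermediate_value ht hb hc' ⟨not_lt.1 hcon, hpos.le⟩
      exact hne s hs hs0
    have := hu.sub_le_of_deriv_le (k := k) (c := c) hab (by
      filter_upwards [h] with t ht htI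
      obtain ⟨D, hD, h1, _⟩ := ht htI
      exact ⟨D, hD, h1 (hall t ⟨htI.1, htI.2.le⟩)⟩)
    rw [abs_of_pos hpos]
    linarith [le_abs_self (u a)]

/-- The last time before `b` at which a continuous function is at most `η`. -/
theorem ContinuousOn.exists_last_le {v : ℝ → ℝ} {a b η : ℝ} (hv : ContinuousOn v (Icc a b))
    (hab : a ≤ b) :
    ∃ t₀ ∈ Icc a b, (t₀ = a ∨ v t₀ ≤ η) ∧ ∀ t ∈ Ioc t₀ b, η < v t := by
  by_cases hne : (Icc a b ∩ v ⁻¹' Iic η).Nonempty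
  · have hcl : IsClosed (Icc a b ∩ v ⁻¹' Iic η) := hv.preimage_isClosed_of_isClosed isClosed_Icc
      isClosed_Iic
    have hcpt : IsCompact (Icc a b ∩ v ⁻¹' Iic η) :=
      isCompact_Icc.of_isClosed_subset hcl inter_subset_left
    obtain ⟨t₀, ht₀, hmax⟩ := hcpt.exists_isGreatest hne
    refine ⟨t₀, ht₀.1, Or.inr ht₀.2, fun t ht => ?_⟩
    by_contra hcon
    exact absurd (hmax ⟨⟨ht₀.1.1.trans ht.1.le, ht.2⟩, not_lt.1 hcon⟩) (not_le.2 ht.1)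
  · refine ⟨a, ⟨le_rfl, hab⟩, Or.inl rfl, fun t ht => ?_⟩
    by_contra hcon
    exact hne ⟨t, ⟨ht.1.le, ht.2⟩, not_lt.1 hcon⟩

/-- If `|u|` decreases at rate at least `r ≥ 0` whenever it exceeds `η ≥ 0`, then it falls to `η`
at that rate and does not exceed `η` afterwards. -/
theorem AbsolutelyContinuousOnInterval.abs_le_max_of_decay {u : ℝ → ℝ} {a b η r : ℝ}
    (hu : AbsolutelyContinuousOnInterval u a b) (hab : a ≤ b) (hη : 0 ≤ η) (hr : 0 ≤ r)
    (h : ∀ᵐ t, t ∈ Ioo a b → ∃ D, HasDerivAt u D t ∧ (η < |u t| →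
      (0 < u t → D ≤ -r) ∧ (u t < 0 → -D ≤ -r))) :
    |u b| ≤ max η (|u a| - r * (b - a)) := by
  have hcont : ContinuousOn (fun t => |u t|) (Icc a b) := by
    have := hu.continuousOn.abs
    rwa [uIcc_of_le hab] at this
  -- After `t₀` the decay is in force without interruption, and it starts either from `a` or from a
  -- value at most `η`.
  obtain ⟨t₀, ht₀, h0, hlt⟩ := hcont.exists_last_le (η := η) hab
  have hsub : uIcc t₀ b ⊆ uIcc a b := by
    rw [uIcc_of_le ht₀.2, uIcc_of_le hab]
    exact Icc_subset_Icc_left ht₀.1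
  have hstep := (hu.mono hsub).abs_le_of_ne_zero (k := -r) (c := 0) ht₀.2
    (fun t ht => abs_pos.1 (hη.trans_lt (hlt t ht))) (by
      filter_upwards [h] with t ht htI
      obtain ⟨D, hD, h1⟩ := ht ⟨ht₀.1.trans_lt htI.1, htI.2⟩
      obtain ⟨h2, h3⟩ := h1 (hlt t ⟨htI.1, htI.2.le⟩)
      exact ⟨D, hD, fun h => by linarith [h2 h], fun h => by linarith [h3 h]⟩)
  have hrt : 0 ≤ r * (b - t₀) := mul_nonneg hr (by linarith [ht₀.2])
  rcases h0 with rfl | h0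
  · exact le_max_of_le_right (by linarith)
  · exact le_max_of_le_left (by linarith)

/-- If `|u|` grows at rate at most `k ≥ 0` away from the zeros of `u`, then its increments are
at most `k` times the length of the interval. -/
theorem AbsolutelyContinuousOnInterval.abs_le_of_growth {u : ℝ → ℝ} {a b k : ℝ}
    (hu : AbsolutelyContinuousOnInterval u a b) (hab : a ≤ b) (hk : 0 ≤ k)
    (h : ∀ᵐ t, t ∈ Ioo a b → ∃ D, HasDerivAt u D t ∧ (0 < u t → D ≤ k) ∧ (u t < 0 → -D ≤ k)) :
    |u b| ≤ |u a| + k * (b - a) := by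
  have hcont : ContinuousOn (fun t => |u t|) (Icc a b) := by
    have := hu.continuousOn.abs
    rwa [uIcc_of_le hab] at this
  obtain ⟨t₀, ht₀, h0, hlt⟩ := hcont.exists_last_le (η := 0) hab
  have hsub : uIcc t₀ b ⊆ uIcc a b := by
    rw [uIcc_of_le ht₀.2, uIcc_of_le hab]
    exact Icc_subset_Icc_left ht₀.1
  have hstep := (hu.mono hsub).abs_le_of_ne_zero (k := k) (c := 0) ht₀.2
    (fun t ht => abs_pos.1 (hlt t ht)) (by
      filter_upwards [h] with t ht htI
      obtain ⟨D, hD, h2, h3⟩ := ht ⟨ht₀.1.trans_lt htI.1, htI.2⟩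
      exact ⟨D, hD, fun h => by linarith [h2 h], fun h => by linarith [h3 h]⟩)
  have hle : k * (b - t₀) ≤ k * (b - a) := mul_le_mul_of_nonneg_left (by linarith [ht₀.1]) hk
  rcases h0 with rfl | h0
  · linarith
  · linarith [abs_nonneg (u a)]

/-! ### Octonion product and Lipschitz bounds for the drift -/

namespace OVNN

theorem omul_sub (a x y : Octonion) : omul a (x - y) = omul a x - omul a y := by
  funext k
  simp only [omul, Pi.sub_apply, ← Finset.sum_sub_distrib]
  refine Finset.sum_congr rfl fun i _ => Finset.sum_congr rfl fun j _ => ?_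
  split_ifs <;> ring

theorem abs_unitSign_le (i j : Fin 8) : |unitSign i j| ≤ 1 := by
  revert i j; decide

/-- There are `8 * 8` pairs of units, each with a structure constant of absolute value at most one.
-/
theorem abs_omul_le (a x : Octonion) (k : Fin 8) : |omul a x k| ≤ 64 * ‖a‖ * ‖x‖ := by
  have hterm : ∀ i j : Fin 8,
      |if unitIdx i j = k then (unitSign i j : ℝ) * a i * x j else 0| ≤ ‖a‖ * ‖x‖ := by
    intro i j
    split_ifs
    · have h1 : |(unitSign i j : ℝ)| ≤ 1 := by exact_mod_cast abs_unitSign_le i j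
      have h2 : |a i| ≤ ‖a‖ := norm_le_pi_norm a i
      have h3 : |x j| ≤ ‖x‖ := norm_le_pi_norm x j
      rw [abs_mul, abs_mul]
      calc |(unitSign i j : ℝ)| * |a i| * |x j| ≤ 1 * ‖a‖ * ‖x‖ := by gcongr
        _ = ‖a‖ * ‖x‖ := by ring
    · simp only [abs_zero]; positivity
  calc |omul a x k| ≤ ∑ i : Fin 8, ∑ j : Fin 8, ‖a‖ * ‖x‖ := by
        refine (Finset.abs_sum_le_sum_abs _ _).trans (Finset.sum_le_sum fun i _ => ?_)
        exact (Finset.abs_sum_le_sum_abs _ _).trans (Finset.sum_le_sum fun j _ => hterm i j)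
    _ = 64 * ‖a‖ * ‖x‖ := by simp; ring

/-- A function with line derivative bounded by `B` in the direction `v` is `B`-Lipschitz along
that direction. -/
theorem abs_sub_le_of_lineDeriv_le {E : Type*} [AddCommGroup E] [Module ℝ E] {φ : E → ℝ} {v : E}
    {B : ℝ} (hdiff : ∀ x, LineDifferentiableAt ℝ φ x v) (hB : ∀ x, |lineDeriv ℝ φ x v| ≤ B)
    (x : E) (c : ℝ) : |φ (x + c • v) - φ x| ≤ B * |c| := by
  have hder : ∀ t : ℝ, HasDerivAt (fun s : ℝ => φ (x + s • v)) (lineDeriv ℝ φ (x + t • v) v) t := by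
    intro t
    have h0 : HasDerivAt (fun s : ℝ => φ (x + t • v + s • v)) (lineDeriv ℝ φ (x + t • v) v)
        (t - t) := by
      rw [sub_self]; exact (hdiff (x + t • v)).hasLineDerivAt
    have h1 := h0.comp_sub_const t t
    refine h1.congr_of_eventuallyEq (Eventually.of_forall fun s => ?_)
    simp only [add_assoc, ← add_smul, add_sub_cancel]
  have := convex_univ.norm_image_sub_le_of_norm_hasDerivWithin_le (C := B)
    (fun t _ => (hder t).hasDerivWithinAt) (fun t _ => hB _) (mem_univ (0 : ℝ)) (mem_univ c)
  simpa using this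

/-- A function on `ℝ^ι` all of whose partial derivatives exist and are bounded by `B` is Lipschitz
for the `ℓ¹`-distance. -/
theorem abs_sub_le_of_partials_le {ι : Type*} [Fintype ι] [DecidableEq ι] {φ : (ι → ℝ) → ℝ} {B : ℝ}
    (hdiff : ∀ l x, LineDifferentiableAt ℝ φ x (Pi.single l 1))
    (hB : ∀ l x, |lineDeriv ℝ φ x (Pi.single l 1)| ≤ B) (x y : ι → ℝ) :
    |φ y - φ x| ≤ ∑ l, B * |y l - x l| := by
  -- The coordinates are changed from `x` to `y` one at a time, so that each step uses a single
  -- partial derivative.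
  have key : ∀ s : Finset ι, |φ (s.piecewise y x) - φ x| ≤ ∑ l ∈ s, B * |y l - x l| := by
    intro s
    induction s using Finset.induction_on with
    | empty => simp
    | insert l s hl ih =>
      have hupd : (insert l s).piecewise y x
          = s.piecewise y x + (y l - x l) • (Pi.single l (1 : ℝ) : ι → ℝ) := by
        funext i
        by_cases hi : i = l
        · subst hi; simp [hl]
        · simp [Finset.piecewise, hi]
      have hstep := abs_sub_le_of_lineDeriv_le (hdiff l) (hB l) (s.piecewise y x) (y l - x l)
      rw [Finset.sum_insert hl, hupd]
      calc _ ≤ _ := abs_sub_le _ (φ (s.piecewise y x)) _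
        _ ≤ _ := add_le_add hstep ih
  simpa using key Finset.univ

variable {n : ℕ}

theorem BoundedPartials.lipschitz {h : Fin n → Octonion → Octonion} (hh : BoundedPartials h) :
    ∃ K, 0 ≤ K ∧ ∀ q x y, ‖h q x - h q y‖ ≤ K * ‖x - y‖ := by
  obtain ⟨bd, hbd⟩ := hh
  set B := ∑ q, ∑ l₁, ∑ l₂, bd q l₁ l₂ with hBdef
  have hpos : ∀ q l₁ l₂, 0 ≤ bd q l₁ l₂ := fun q l₁ l₂ => (hbd q l₁ l₂).1.le
  have hle : ∀ q l₁ l₂, bd q l₁ l₂ ≤ B := by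
    intro q l₁ l₂
    calc bd q l₁ l₂ ≤ ∑ l₂, bd q l₁ l₂ :=
          Finset.single_le_sum (f := fun l₂ => bd q l₁ l₂) (fun l _ => hpos q l₁ l)
            (Finset.mem_univ l₂)
      _ ≤ ∑ l₁, ∑ l₂, bd q l₁ l₂ :=
          Finset.single_le_sum (f := fun l₁ => ∑ l₂, bd q l₁ l₂)
            (fun l _ => Finset.sum_nonneg fun l' _ => hpos q l l') (Finset.mem_univ l₁)
      _ ≤ B := Finset.single_le_sum (f := fun q => ∑ l₁, ∑ l₂, bd q l₁ l₂)
            (fun q _ => Finset.sum_nonneg fun l _ => Finset.sum_nonneg fun l' _ => hpos q l l')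
            (Finset.mem_univ q)
  have hB0 : 0 ≤ B := Finset.sum_nonneg fun q _ => Finset.sum_nonneg fun l _ =>
    Finset.sum_nonneg fun l' _ => hpos q l l'
  refine ⟨8 * B, by positivity, fun q x y => ?_⟩
  refine (pi_norm_le_iff_of_nonneg (by positivity)).2 fun l₁ => ?_
  have hcomp := abs_sub_le_of_partials_le (φ := fun y => h q y l₁) (B := B)
    (fun l₂ x => (hbd q l₁ l₂).2.1 x)
    (fun l₂ x => by
      obtain ⟨h0, h1⟩ := (hbd q l₁ l₂).2.2.2 x
      rw [abs_of_nonneg h0]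
      exact h1.trans (hle q l₁ l₂)) y x
  calc ‖(h q x - h q y) l₁‖ ≤ ∑ l : Fin 8, B * |x l - y l| := hcomp
    _ ≤ ∑ l : Fin 8, B * ‖x - y‖ := Finset.sum_le_sum fun l _ =>
        mul_le_mul_of_nonneg_left (norm_le_pi_norm (x - y) l) hB0
    _ = 8 * B * ‖x - y‖ := by simp; ring

/-- The inputs cancel and only increments of the activations remain, to which the Lipschitz bounds
apply. -/
theorem Network.drift_sub_residual (N : Network n) (z : Fin n → Octonion)
    (w : ℝ → Fin n → Octonion) (t : ℝ) (p : Fin n) :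
    N.drift w t p - N.residual z p = -(N.d p • (w t p - z p))
      + ∑ q, omul (N.a p q) (N.f q (w t q) - N.f q (z q))
      + ∑ q, omul (N.b p q) (N.g q (w (t - N.delay p q t) q) - N.g q (z q)) := by
  simp only [Network.drift, Network.residual, omul_sub, Finset.sum_sub_distrib,
    Finset.sum_add_distrib, smul_sub]
  abel

/-- The drift deviates from the residual at the target by at most a multiple of the error, taken
at the present and at the delayed times. -/
theorem Network.exists_drift_bound (N : Network n) (hf : BoundedPartials N.f)
    (hg : BoundedPartials N.g) (z : Fin n → Octonion) :
    ∃ A, 0 ≤ A ∧ ∀ (w : ℝ → Fin n → Octonion) (t : ℝ) (R : ℝ), ‖w t - z‖ ≤ R →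
      (∀ p q, ‖w (t - N.delay p q t) - z‖ ≤ R) →
        ∀ p l, |N.drift w t p l - N.residual z p l| ≤ A * R := by
  obtain ⟨Kf, hKf, hf'⟩ := hf.lipschitz
  obtain ⟨Kg, hKg, hg'⟩ := hg.lipschitz
  set P : Fin n → ℝ := fun p =>
    |N.d p| + ∑ q, 64 * ‖N.a p q‖ * Kf + ∑ q, 64 * ‖N.b p q‖ * Kg with hP
  have hP0 : ∀ p, 0 ≤ P p := fun p => by positivity
  refine ⟨∑ p, P p, Finset.sum_nonneg fun p _ => hP0 p, fun w t R hR hRd p l => ?_⟩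
  have hR0 : 0 ≤ R := (norm_nonneg _).trans hR
  have hcomp : ∀ {y : Fin n → Octonion}, ‖y - z‖ ≤ R → ∀ q, ‖y q - z q‖ ≤ R :=
    fun hy q => (norm_le_pi_norm (_ - z) q).trans hy
  have hkey : |N.drift w t p l - N.residual z p l| ≤ P p * R := by
    have := congrFun (N.drift_sub_residual z w t p) l
    rw [Pi.sub_apply] at this
    rw [this]
    simp only [Pi.add_apply, Pi.neg_apply, Pi.smul_apply, smul_eq_mul, Finset.sum_apply]
    have h1 : |-(N.d p * (w t p - z p) l)| ≤ |N.d p| * R := by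
      rw [abs_neg, abs_mul]
      exact mul_le_mul_of_nonneg_left ((norm_le_pi_norm (w t p - z p) l).trans (hcomp hR p))
        (abs_nonneg _)
    have h2 : |∑ q, omul (N.a p q) (N.f q (w t q) - N.f q (z q)) l|
        ≤ ∑ q, 64 * ‖N.a p q‖ * Kf * R := by
      refine (Finset.abs_sum_le_sum_abs _ _).trans (Finset.sum_le_sum fun q _ => ?_)
      refine (abs_omul_le _ _ _).trans ?_
      rw [mul_assoc _ Kf]
      have := (hf' q (w t q) (z q)).trans (mul_le_mul_of_nonneg_left (hcomp hR q) hKf)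
      gcongr
    have h3 : |∑ q, omul (N.b p q) (N.g q (w (t - N.delay p q t) q) - N.g q (z q)) l|
        ≤ ∑ q, 64 * ‖N.b p q‖ * Kg * R := by
      refine (Finset.abs_sum_le_sum_abs _ _).trans (Finset.sum_le_sum fun q _ => ?_)
      refine (abs_omul_le _ _ _).trans ?_
      rw [mul_assoc _ Kg]
      have := (hg' q (w (t - N.delay p q t) q) (z q)).trans
        (mul_le_mul_of_nonneg_left (hcomp (hRd p q) q) hKg)
      gcongr
    rw [hP]
    simp only [add_mul, Finset.sum_mul]
    exact (abs_add_le _ _).trans (add_le_add ((abs_add_le _ _).trans (add_le_add h1 h2)) h3)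
  exact hkey.trans (mul_le_mul_of_nonneg_right
    (Finset.single_le_sum (fun p _ => hP0 p) (Finset.mem_univ p)) hR0)

/-! ### Weighted norm, adaptive rates and delay windows -/

theorem wnorm_nonneg (Lam : Fin n → Fin 8 → ℝ) (y : Fin n → Octonion) : 0 ≤ wnorm Lam y :=
  Real.iSup_nonneg fun _ => Real.iSup_nonneg fun _ => abs_nonneg _

theorem exists_wnorm_le (Lam : Fin n → Fin 8 → ℝ) :
    ∃ M, 0 < M ∧ ∀ y, wnorm Lam y ≤ M * ‖y‖ := by
  refine ⟨∑ p, ∑ l, |(Lam p l)⁻¹| + 1, by positivity, fun y => ?_⟩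
  refine Real.iSup_le (fun l => Real.iSup_le (fun p => ?_) (by positivity)) (by positivity)
  have h1 : |y p l| ≤ ‖y‖ := (norm_le_pi_norm (y p) l).trans (norm_le_pi_norm y p)
  have h2 : |(Lam p l)⁻¹| ≤ ∑ p, ∑ l, |(Lam p l)⁻¹| :=
    (Finset.single_le_sum (f := fun l => |(Lam p l)⁻¹|) (fun l _ => abs_nonneg _)
      (Finset.mem_univ l)).trans
    (Finset.single_le_sum (f := fun p => ∑ l, |(Lam p l)⁻¹|)
      (fun p _ => Finset.sum_nonneg fun l _ => abs_nonneg _) (Finset.mem_univ p))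
  rw [abs_mul]
  exact mul_le_mul (by linarith) h1 (abs_nonneg _) (by positivity)

theorem exists_le_wnorm {Lam : Fin n → Fin 8 → ℝ} (hLam : ∀ p l, 0 < Lam p l) :
    ∃ M, 0 < M ∧ ∀ y, ‖y‖ ≤ M * wnorm Lam y := by
  have hs : 0 ≤ ∑ p, ∑ l, Lam p l :=
    Finset.sum_nonneg fun p _ => Finset.sum_nonneg fun l _ => (hLam p l).le
  refine ⟨∑ p, ∑ l, Lam p l + 1, by positivity, fun y => ?_⟩
  have hw := wnorm_nonneg Lam y
  refine (pi_norm_le_iff_of_nonneg (by positivity)).2 fun p =>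
    (pi_norm_le_iff_of_nonneg (by positivity)).2 fun l => ?_
  have h1 : |(Lam p l)⁻¹ * y p l| ≤ wnorm Lam y :=
    (le_ciSup (f := fun p => |(Lam p l)⁻¹ * y p l|) (Set.finite_range _).bddAbove p).trans
      (le_ciSup (f := fun l => ⨆ p, |(Lam p l)⁻¹ * y p l|) (Set.finite_range _).bddAbove l)
  have h2 : Lam p l ≤ ∑ p, ∑ l, Lam p l :=
    (Finset.single_le_sum (f := fun l => Lam p l) (fun l _ => (hLam p l).le)
      (Finset.mem_univ l)).trans
    (Finset.single_le_sum (f := fun p => ∑ l, Lam p l)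
      (fun p _ => Finset.sum_nonneg fun l _ => (hLam p l).le) (Finset.mem_univ p))
  rw [abs_mul, abs_of_pos (inv_pos.2 (hLam p l)), inv_mul_le_iff₀ (hLam p l)] at h1
  exact h1.trans (mul_le_mul_of_nonneg_right (by linarith) hw)

theorem rateConst_nonneg {c₁ : ℝ} (hc₁ : 0 ≤ c₁) (S : ℝ) : 0 ≤ rateConst c₁ S := by
  unfold rateConst; split_ifs <;> simp [hc₁]

theorem rateConst_of_pos_of_le {c₁ S : ℝ} (h0 : 0 < S) (h1 : S ≤ 1) : rateConst c₁ S = c₁ := by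
  simp [rateConst, h0.ne', h1]

theorem min_mul_le_rateProp {c₂ c₃ m y : ℝ} (hc₂ : 0 ≤ c₂) (hm : 1 ≤ m) (hy : 0 ≤ y) (S : ℝ) :
    min c₂ c₃ * y ≤ rateProp c₂ c₃ m S y := by
  unfold rateProp
  split_ifs
  · exact mul_le_mul_of_nonneg_right (min_le_right _ _) hy
  · refine mul_le_mul_of_nonneg_right ((min_le_left _ _).trans ?_) hy
    exact le_mul_of_one_le_right hc₂ hm

/-- The window supremum is positive if the error is nonzero at some time of the window. -/
theorem windowSup_pos {Lam : Fin n → Fin 8 → ℝ} (hLam : ∀ p l, 0 < Lam p l) {z : Fin n → Octonion}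
    {τ : ℝ → ℝ} {w : ℝ → Fin n → Octonion} (hw : Continuous w) {s t : ℝ}
    (hs : s ∈ Icc (t - τ t) t) (hne : w s ≠ z) : 0 < windowSup Lam z τ w t := by
  obtain ⟨M, hM, hMle⟩ := exists_wnorm_le Lam
  obtain ⟨M', hM', hM'le⟩ := exists_le_wnorm hLam
  -- The real `sSup` of an unbounded set is `0`, so a bound over the compact window is needed first.
  have hcont : Continuous fun s => M * ‖w s - z‖ := by fun_prop
  obtain ⟨B, hB⟩ := (isCompact_Icc (a := t - τ t) (b := t)).bddAbove_image hcont.continuousOn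
  have hbdd : BddAbove ((fun s => wnorm Lam (w s - z)) '' Icc (t - τ t) t) := by
    refine ⟨B, ?_⟩
    rintro _ ⟨r, hr, rfl⟩
    exact (hMle _).trans (hB ⟨r, hr, rfl⟩)
  refine lt_of_lt_of_le ?_ (le_csSup hbdd ⟨s, hs, rfl⟩)
  have h1 : 0 < ‖w s - z‖ := norm_pos_iff.2 (sub_ne_zero.2 hne)
  exact pos_of_mul_pos_right (h1.trans_le (hM'le _)) hM'.le

theorem windowSup_le {Lam : Fin n → Fin 8 → ℝ} {z : Fin n → Octonion}
    {τ : ℝ → ℝ} {w : ℝ → Fin n → Octonion} {t B : ℝ} (hB : 0 ≤ B)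
    (h : ∀ s ∈ Icc (t - τ t) t, wnorm Lam (w s - z) ≤ B) : windowSup Lam z τ w t ≤ B := by
  refine Real.sSup_le ?_ hB
  rintro _ ⟨s, hs, rfl⟩
  exact h s hs

/-- `t - τ t` is eventually nonnegative and continuous before that. Hence all windows lie in one
half-line `[h, ∞)`, although the delays may be unbounded, and maxima over `Icc h t` control them. -/
theorem DelayBound.exists_lower {N : Network n} {τ : ℝ → ℝ} (hτ : DelayBound N τ) :
    ∃ h, h ≤ 0 ∧ ∀ t, 0 ≤ t → h ≤ t - τ t := by
  obtain ⟨T, hT⟩ := (hτ.tendsto_sub.eventually_ge_atTop 0).exists_forall_of_atTop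
  obtain ⟨m, hm⟩ := (isCompact_Icc (a := 0) (b := T)).bddBelow_image
    (f := fun t => t - τ t) (continuousOn_id.sub (hτ.cont.mono Icc_subset_Ici_self))
  refine ⟨min m 0, min_le_right _ _, fun t ht => ?_⟩
  rcases le_total t T with h | h
  · exact (min_le_left _ _).trans (hm ⟨t, ⟨ht, h⟩, rfl⟩)
  · exact (min_le_right _ _).trans (hT t h)

end OVNN

/-! ### The differential inequality for the error -/

namespace OVNN

variable {n : ℕ}

theorem LocallyAC.on {x : ℝ → ℝ} (hx : LocallyAC x) {a b : ℝ} (ha : 0 ≤ a) (hab : a ≤ b) :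
    AbsolutelyContinuousOnInterval x a b := by
  refine (hx (b + 1) (by linarith)).mono ?_
  rw [uIcc_of_le hab, uIcc_of_le (by linarith)]
  exact Icc_subset_Icc ha (by linarith)

/-- The differential inequality satisfied by the error `y` of a delayed system under a controller
with proportional gain `κ` and constant gain `κh`: away from its zeros, each `|y_p^l|` grows at
rate at most `A R + C - κh - κ |y_p^l|`, where `R` bounds the error over the delay window. -/
structure ErrorSystem (y : ℝ → Fin n → Octonion) (τ κ κh : ℝ → ℝ) (A C h : ℝ) : Prop where
  cont : Continuous y
  ac : ∀ p l, LocallyAC (fun t => y t p l)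
  A_nonneg : 0 ≤ A
  h_nonpos : h ≤ 0
  window : ∀ t, 0 ≤ t → h ≤ t - τ t
  rate : ∀ p l, ∀ᵐ t, 0 < t → ∃ D, HasDerivAt (fun r => y r p l) D t ∧
    ∀ R, (∀ s ∈ Icc (t - τ t) t, ‖y s‖ ≤ R) →
      (0 < y t p l → D ≤ A * R + C - κh t - κ t * |y t p l|) ∧
      (y t p l < 0 → -D ≤ A * R + C - κh t - κ t * |y t p l|)

theorem abs_apply_le_norm (y : Fin n → Octonion) (p : Fin n) (l : Fin 8) : |y p l| ≤ ‖y‖ :=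
  (norm_le_pi_norm (y p) l).trans (norm_le_pi_norm y p)

theorem norm_le_of_abs_apply_le {y : Fin n → Octonion} {r : ℝ} (hr : 0 ≤ r)
    (h : ∀ p l, |y p l| ≤ r) : ‖y‖ ≤ r :=
  (pi_norm_le_iff_of_nonneg hr).2 fun p => (pi_norm_le_iff_of_nonneg hr).2 fun l => h p l

namespace ErrorSystem

variable {y : ℝ → Fin n → Octonion} {τ κ κh : ℝ → ℝ} {A C h : ℝ}

/-- Each component decays separately, hence so does the maximum. The rate is required for all `x` in
`(η, R]` because the proportional term sees the component, not the norm. -/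
theorem decay (E : ErrorSystem y τ κ κh A C h) {a b η r R : ℝ} (ha : 0 ≤ a) (hab : a ≤ b)
    (hη : 0 ≤ η) (hr : 0 ≤ r) (hR : ∀ s ∈ Icc h b, ‖y s‖ ≤ R)
    (hrate : ∀ t ∈ Ioo a b, ∀ x, η < x → x ≤ R → A * R + C - κh t - κ t * x ≤ -r) :
    ‖y b‖ ≤ max η (‖y a‖ - r * (b - a)) := by
  refine norm_le_of_abs_apply_le (le_max_of_le_left hη) fun p l => ?_
  have := ((E.ac p l).on ha hab).abs_le_max_of_decay hab hη hr (by
    filter_upwards [E.rate p l] with t ht htI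
    have ht0 : 0 < t := ha.trans_lt htI.1
    obtain ⟨D, hD, hDR⟩ := ht ht0
    obtain ⟨h1, h2⟩ := hDR R fun s hs =>
      hR s ⟨(E.window t ht0.le).trans hs.1, hs.2.trans htI.2.le⟩
    have hx : |y t p l| ≤ R := (abs_apply_le_norm _ _ _).trans
      (hR t ⟨E.h_nonpos.trans ht0.le, htI.2.le⟩)
    exact ⟨D, hD, fun hlt => ⟨fun hp => (h1 hp).trans (hrate t htI _ hlt hx),
      fun hn => (h2 hn).trans (hrate t htI _ hlt hx)⟩⟩)
  exact this.trans (max_le_max le_rfl (by linarith [abs_apply_le_norm (y a) p l]))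

theorem growth (E : ErrorSystem y τ κ κh A C h) {a b k R : ℝ} (ha : 0 ≤ a) (hab : a ≤ b)
    (hk : 0 ≤ k) (hR : ∀ s ∈ Icc h b, ‖y s‖ ≤ R)
    (hrate : ∀ t ∈ Ioo a b, ∀ x, 0 < x → x ≤ R → A * R + C - κh t - κ t * x ≤ k) :
    ‖y b‖ ≤ ‖y a‖ + k * (b - a) := by
  have hkab : 0 ≤ k * (b - a) := mul_nonneg hk (by linarith)
  refine norm_le_of_abs_apply_le (by positivity) fun p l => ?_
  have := ((E.ac p l).on ha hab).abs_le_of_growth hab hk (by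
    filter_upwards [E.rate p l] with t ht htI
    have ht0 : 0 < t := ha.trans_lt htI.1
    obtain ⟨D, hD, hDR⟩ := ht ht0
    obtain ⟨h1, h2⟩ := hDR R fun s hs =>
      hR s ⟨(E.window t ht0.le).trans hs.1, hs.2.trans htI.2.le⟩
    have hx : |y t p l| ≤ R := (abs_apply_le_norm _ _ _).trans
      (hR t ⟨E.h_nonpos.trans ht0.le, htI.2.le⟩)
    exact ⟨D, hD, fun hp => (h1 hp).trans (hrate t htI _ (abs_pos.2 hp.ne') hx),
      fun hn => (h2 hn).trans (hrate t htI _ (abs_pos.2 hn.ne) hx)⟩)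
  linarith [abs_apply_le_norm (y a) p l]

/-- The error is bounded if its large record values are. -/
theorem bounded_of_records (E : ErrorSystem y τ κ κh A C h) {T B : ℝ} (hT : 0 ≤ T)
    (hB : ∀ t, T ≤ t → 1 < ‖y t‖ → (∀ s ∈ Icc h t, ‖y s‖ ≤ ‖y t‖) → ‖y t‖ ≤ B) :
    ∃ B', 1 ≤ B' ∧ ∀ t, h ≤ t → ‖y t‖ ≤ B' := by
  have hmax : ∀ t, h ≤ t → ∃ s₀ ∈ Icc h t, ∀ s ∈ Icc h t, ‖y s‖ ≤ ‖y s₀‖ := fun t ht =>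
    isCompact_Icc.exists_isMaxOn ⟨h, le_rfl, ht⟩ E.cont.norm.continuousOn
  obtain ⟨s₁, hs₁, hmax₁⟩ := hmax T (E.h_nonpos.trans hT)
  refine ⟨max 1 (max B ‖y s₁‖), le_max_left _ _, fun t ht => ?_⟩
  obtain ⟨s₀, hs₀, hmax₀⟩ := hmax t ht
  refine (hmax₀ t ⟨ht, le_rfl⟩).trans ?_
  rcases le_total s₀ T with hle | hle
  · exact le_max_of_le_right (le_max_of_le_right (hmax₁ s₀ ⟨hs₀.1, hle⟩))
  · rcases le_or_gt ‖y s₀‖ 1 with h1 | h1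
    · exact le_max_of_le_left h1
    · exact le_max_of_le_right (le_max_of_le_left
        (hB s₀ hle h1 fun s hs => hmax₀ s ⟨hs.1, hs.2.trans hs₀.2⟩))

/-- If the proportional gain is unbounded, the error is bounded and tends to zero. -/
theorem tendsto_zero_of_gain_tendsto (E : ErrorSystem y τ κ κh A C h) {κh₀ : ℝ}
    (hκh : ∀ t, 0 ≤ t → κh₀ ≤ κh t) (hκ : Tendsto κ atTop atTop) :
    (∃ B, 1 ≤ B ∧ ∀ t, h ≤ t → ‖y t‖ ≤ B) ∧ ∀ η, 0 < η → ∃ T, ∀ t, T ≤ t → ‖y t‖ ≤ η := by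
  set c := |C - κh₀| with hc
  have hc0 : 0 ≤ c := abs_nonneg _
  have hcle : ∀ t, 0 ≤ t → C - κh t ≤ c := fun t ht => by
    linarith [le_abs_self (C - κh₀), hκh t ht]
  have hA := E.A_nonneg
  have hlarge : ∀ K, ∃ T, 0 ≤ T ∧ ∀ t, T ≤ t → K ≤ κ t := by
    intro K
    obtain ⟨T, hT⟩ := (hκ.eventually_ge_atTop K).exists_forall_of_atTop
    exact ⟨max T 0, le_max_right _ _, fun t ht => hT t ((le_max_left _ _).trans ht)⟩
  have hbdd : ∃ B, 1 ≤ B ∧ ∀ t, h ≤ t → ‖y t‖ ≤ B := by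
    -- At a record value `R > 1`, this gain makes the rate nonpositive above `R / 2`, as `(A + c) R
    -- ≥ A R + c`. A record after `T` thus cannot exceed `‖y T‖`.
    obtain ⟨T, hT0, hT⟩ := hlarge (2 * (A + c))
    refine E.bounded_of_records hT0 (B := ‖y T‖) fun t ht h1 hrec => ?_
    have := E.decay hT0 ht (η := ‖y t‖ / 2) (r := 0) (by positivity) le_rfl hrec (by
      intro s hs x hx _
      have hK := hT s hs.1.le
      have hC := hcle s (hT0.trans hs.1.le)
      have h2 : 2 * (A + c) * (‖y t‖ / 2) ≤ κ s * x :=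
        mul_le_mul hK hx.le (by positivity) (by linarith)
      nlinarith)
    rcases le_max_iff.1 this with h3 | h3
    · linarith
    · linarith
  obtain ⟨B, hB1, hB⟩ := hbdd
  refine ⟨⟨B, hB1, hB⟩, fun η hη => ?_⟩
  -- Above `η` the rate is then at most `-1`, so a time `B` suffices to descend from `B`.
  obtain ⟨T, hT0, hT⟩ := hlarge ((A * B + c + 1) / η)
  refine ⟨T + B, fun t ht => ?_⟩
  have := E.decay hT0 (b := t) (by linarith) hη.le (r := 1) zero_le_one
    (fun s hs => hB s hs.1) (by
      intro s hs x hx _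
      have hK := hT s hs.1.le
      have hC := hcle s (hT0.trans hs.1.le)
      have hpos : 0 ≤ (A * B + c + 1) / η := by positivity
      have h2 : (A * B + c + 1) / η * η ≤ κ s * x := mul_le_mul hK hx.le hη.le (by linarith)
      rw [div_mul_cancel₀ _ hη.ne'] at h2
      linarith)
  have hyT := hB T (E.h_nonpos.trans hT0)
  exact this.trans (max_le le_rfl (by linarith))

/-- If the proportional gain converges while growing at a rate proportional to the error, the error
is bounded and tends to zero. -/
theorem tendsto_zero_of_gain_cauchy (E : ErrorSystem y τ κ κh A C h) {κh₀ K₀ T₀ c₀ : ℝ}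
    (hκh : ∀ t, 0 ≤ t → κh₀ ≤ κh t) (hK₀ : 0 ≤ K₀) (hκ : ∀ t, 0 ≤ t → -K₀ ≤ κ t) (hc₀ : 0 < c₀)
    (hinc : ∀ a b m, T₀ ≤ a → a ≤ b → 0 ≤ m → (∀ s ∈ Icc a b, m ≤ ‖y s‖) →
      c₀ * m * (b - a) ≤ κ b - κ a)
    (hcauchy : ∀ ε, 0 < ε → ∃ T, ∀ a b, T ≤ a → a ≤ b → κ b - κ a < ε) :
    (∃ B, 1 ≤ B ∧ ∀ t, h ≤ t → ‖y t‖ ≤ B) ∧ ∀ η, 0 < η → ∃ T, ∀ t, T ≤ t → ‖y t‖ ≤ η := by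
  -- For `R ≥ 1` bounding the past, `A₂ R` bounds the growth rate of the error; the `1` makes `A₂`
  -- positive.
  set A₂ := A + |C - κh₀| + K₀ + 1 with hA₂
  have hA := E.A_nonneg
  have hc0 : 0 ≤ |C - κh₀| := abs_nonneg _
  have hA₂pos : 0 < A₂ := by positivity
  -- An error of at least `η` at time `t` was at least `η / 2` throughout `[t - c, t]`, which costs
  -- `κ` a definite increase.
  have persist : ∀ {t c R η : ℝ}, 0 ≤ t - c → T₀ ≤ t - c → 0 ≤ c → 1 ≤ R →
      (∀ s ∈ Icc h t, ‖y s‖ ≤ R) → 0 ≤ η → η ≤ ‖y t‖ → A₂ * R * c ≤ η / 2 →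
      c₀ * (η / 2) * c ≤ κ t - κ (t - c) := by
    intro t c R η htc hT hc hR1 hR hη0 hη hsmall
    have := hinc (t - c) t (η / 2) hT (by linarith) (by linarith) (fun s hs => by
      have hs0 : 0 ≤ s := htc.trans hs.1
      have hg := E.growth hs0 hs.2 (k := A₂ * R) (by positivity) hR (by
        intro r hr x hx hxR
        have hr0 := hs0.trans hr.1.le
        have h1 : -K₀ * x ≤ κ r * x := mul_le_mul_of_nonneg_right (hκ r hr0) hx.le
        have h2 : K₀ * x ≤ K₀ * R := mul_le_mul_of_nonneg_left hxR hK₀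
        have h3 : |C - κh₀| ≤ |C - κh₀| * R := le_mul_of_one_le_right hc0 hR1
        have h4 := le_abs_self (C - κh₀)
        have h5 := hκh r hr0
        rw [hA₂]
        linarith)
      have h6 : A₂ * R * (t - s) ≤ A₂ * R * c :=
        mul_le_mul_of_nonneg_left (by linarith [hs.1]) (by positivity)
      linarith)
    rwa [sub_sub_cancel] at this
  have hbdd : ∃ B, 1 ≤ B ∧ ∀ t, h ≤ t → ‖y t‖ ≤ B := by
    -- For a record, `R = η = ‖y t‖`, so this length works for every record value. Late records
    -- above `1` are therefore impossible.
    set c := 1 / (2 * A₂) with hc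
    have hcpos : 0 < c := by positivity
    obtain ⟨T, hT⟩ := hcauchy (c₀ * (1 / 2) * c) (by positivity)
    refine E.bounded_of_records (T := max (max T T₀) 0 + c) (B := 1)
      (by positivity) fun t ht h1 hrec => ?_
    have hm : max (max T T₀) 0 ≤ t - c := by linarith
    have hm1 := (max_le_iff.1 hm).2
    have hm2 := max_le_iff.1 (max_le_iff.1 hm).1
    have h2 := persist hm1 hm2.2 hcpos.le h1.le hrec (norm_nonneg (y t)) le_rfl (by
      rw [hc]; field_simp; rfl)
    have h3 := hT (t - c) t hm2.1 (by linarith)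
    have h4 : c₀ * (1 / 2) * c ≤ c₀ * (‖y t‖ / 2) * c := by gcongr
    linarith
  obtain ⟨B, hB1, hB⟩ := hbdd
  refine ⟨⟨B, hB1, hB⟩, fun η hη => ?_⟩
  set c := η / (2 * (A₂ * B)) with hc
  have hcpos : 0 < c := by positivity
  obtain ⟨T, hT⟩ := hcauchy (c₀ * (η / 2) * c) (by positivity)
  refine ⟨max (max T T₀) 0 + c, fun t ht => ?_⟩
  by_contra hcon
  have hm : max (max T T₀) 0 ≤ t - c := by linarith
  have hm1 := (max_le_iff.1 hm).2
  have hm2 := max_le_iff.1 (max_le_iff.1 hm).1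
  have h2 := persist hm1 hm2.2 hcpos.le hB1 (fun s hs => hB s hs.1) hη.le (not_le.1 hcon).le (by
    rw [hc]; apply le_of_eq; field_simp)
  have h3 := hT (t - c) t hm2.1 (by linarith)
  linarith

/-- If the constant gain is unbounded, a bounded error vanishes in finite time. -/
theorem eq_zero_of_gainh_tendsto (E : ErrorSystem y τ κ κh A C h) {K₀ B : ℝ} (hK₀ : 0 ≤ K₀)
    (hκ : ∀ t, 0 ≤ t → -K₀ ≤ κ t) (hB : ∀ t, h ≤ t → ‖y t‖ ≤ B)
    (hκh : Tendsto κh atTop atTop) : ∃ T, 0 ≤ T ∧ ∀ t, T ≤ t → y t = 0 := by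
  -- The term `K₀ * B` compensates a possibly negative `κ`. The decay is at unit rate all the way
  -- down to `η = 0`, whence finite time.
  obtain ⟨T, hT⟩ := (hκh.eventually_ge_atTop (A * B + C + K₀ * B + 1)).exists_forall_of_atTop
  have hB0 : 0 ≤ B := (norm_nonneg _).trans (hB h le_rfl)
  refine ⟨max T 0 + B, by positivity, fun t ht => ?_⟩
  have hT0 : 0 ≤ max T 0 := le_max_right _ _
  have := E.decay hT0 (b := t) (by linarith) le_rfl (r := 1) zero_le_one
    (fun s hs => hB s hs.1) (by
      intro s hs x hx hxB
      have h1 : -K₀ * x ≤ κ s * x := mul_le_mul_of_nonneg_right (hκ s (hT0.trans hs.1.le)) hx.le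
      have h2 : K₀ * x ≤ K₀ * B := mul_le_mul_of_nonneg_left hxB hK₀
      have h3 := hT s ((le_max_left _ _).trans hs.1.le)
      linarith)
  have hyT := hB _ (E.h_nonpos.trans hT0)
  have h0 : ‖y t‖ ≤ 0 := this.trans (max_le le_rfl (by linarith))
  exact norm_le_zero_iff.1 h0

end ErrorSystem

end OVNN

/-! ### The adaptive gains and finite-time convergence -/

namespace OVNN

variable {n : ℕ}

/-- A function that is monotone on `[T, ∞)` tends to infinity or converges to an upper bound. -/
theorem tendsto_atTop_or_of_monotoneOn {k : ℝ → ℝ} {T : ℝ}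
    (hk : ∀ a b, T ≤ a → a ≤ b → k a ≤ k b) :
    Tendsto k atTop atTop ∨ ∃ l, Tendsto k atTop (𝓝 l) ∧ ∀ t, T ≤ t → k t ≤ l := by
  have hmono : Monotone fun t => k (max t T) := fun a b hab =>
    hk _ _ (le_max_right _ _) (max_le_max hab le_rfl)
  have heq : (fun t => k (max t T)) =ᶠ[atTop] k := by
    filter_upwards [eventually_ge_atTop T] with t ht
    rw [max_eq_left ht]
  rcases tendsto_atTop_of_monotone hmono with h | ⟨l, h⟩
  · exact Or.inl (h.congr' heq)
  · refine Or.inr ⟨l, h.congr' heq, fun t ht => ?_⟩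
    have := hmono.ge_of_tendsto h t
    rwa [max_eq_left ht] at this

theorem DelayBound.nonneg {N : Network n} {τ : ℝ → ℝ} (hτ : DelayBound N τ) (p : Fin n) {t : ℝ}
    (ht : 0 ≤ t) : 0 ≤ τ t :=
  (hτ.delay_nonneg p p t ht).trans (hτ.delay_le p p t ht)

namespace IsControlledSolution

variable {N : Network n} {z : Fin n → Octonion} {Lam : Fin n → Fin 8 → ℝ} {τ μ : ℝ → ℝ}
  {c₁ c₂ c₃ κ₀ κh₀ : ℝ} {w : ℝ → Fin n → Octonion} {κ κh : ℝ → ℝ}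

/-- Only the signs at nonzero errors enter, so every Filippov selection at zero is admissible. -/
theorem errorSystem (hs : IsControlledSolution N z Lam τ μ c₁ c₂ c₃ κ₀ κh₀ w κ κh)
    (hτ : DelayBound N τ) {A C h : ℝ} (hA : 0 ≤ A)
    (hdrift : ∀ (w : ℝ → Fin n → Octonion) (t R : ℝ), ‖w t - z‖ ≤ R →
      (∀ p q, ‖w (t - N.delay p q t) - z‖ ≤ R) →
        ∀ p l, |N.drift w t p l - N.residual z p l| ≤ A * R)
    (hC : ∀ p l, |N.residual z p l| ≤ C) (hh : h ≤ 0) (hwin : ∀ t, 0 ≤ t → h ≤ t - τ t) :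
    ErrorSystem (fun t => w t - z) τ κ κh A C h where
  cont := hs.history.sub continuous_const
  ac := by
    intro p l T hT
    have hconst : AbsolutelyContinuousOnInterval (fun _ : ℝ => z p l) 0 T :=
      (contDiff_const.contDiffOn).absolutelyContinuousOnInterval
    exact (hs.state_ac p l T hT).sub hconst
  A_nonneg := hA
  h_nonpos := hh
  window := hwin
  rate := by
    intro p l
    filter_upwards [(ae_restrict_iff' measurableSet_Ioi).1 (hs.state_eq p l)] with t ht ht0
    obtain ⟨s, hsgn, hD⟩ := ht ht0
    refine ⟨_, hD.sub_const (z p l), fun R hR => ?_⟩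
    have hτ0 := hτ.nonneg p ht0.le
    have hb := hdrift w t R (hR t ⟨by linarith, le_rfl⟩) (fun p q => hR _
      ⟨by linarith [hτ.delay_le p q t ht0.le], by linarith [hτ.delay_nonneg p q t ht0.le]⟩) p l
    have h1 := abs_le.1 hb
    have h2 := abs_le.1 (hC p l)
    simp only [Pi.sub_apply]
    refine ⟨fun hp => ?_, fun hn => ?_⟩
    · rw [hsgn.2.1 hp]
      linarith
    · rw [hsgn.2.2 hn]
      linarith

theorem gainh_mono (hs : IsControlledSolution N z Lam τ μ c₁ c₂ c₃ κ₀ κh₀ w κ κh) (hc₁ : 0 ≤ c₁)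
    (a b : ℝ) (ha : 0 ≤ a) (hab : a ≤ b) : κh a ≤ κh b := by
  have := (hs.gainh_ac.on ha hab).le_sub_of_le_deriv (k := 0) hab (by
    filter_upwards [(ae_restrict_iff' measurableSet_Ioi).1 hs.gainh_eq] with t ht htI
    exact ⟨_, ht (ha.trans_lt htI.1), rateConst_nonneg hc₁ _⟩)
  linarith

/-- While the window supremum lies in `(0, 1]`, the constant gain grows at rate `c₁`. -/
theorem le_gainh_sub (hs : IsControlledSolution N z Lam τ μ c₁ c₂ c₃ κ₀ κh₀ w κ κh) {a b : ℝ}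
    (ha : 0 ≤ a) (hab : a ≤ b)
    (hS : ∀ t ∈ Ioo a b, 0 < windowSup Lam z τ w t ∧ windowSup Lam z τ w t ≤ 1) :
    c₁ * (b - a) ≤ κh b - κh a := by
  refine (hs.gainh_ac.on ha hab).le_sub_of_le_deriv hab ?_
  filter_upwards [(ae_restrict_iff' measurableSet_Ioi).1 hs.gainh_eq] with t ht htI
  exact ⟨_, ht (ha.trans_lt htI.1), (rateConst_of_pos_of_le (hS t htI).1 (hS t htI).2).ge⟩

/-- While the window supremum is at most `1`, the proportional gain does not decrease. -/
theorem gain_le_of_windowSup_le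
    (hs : IsControlledSolution N z Lam τ μ c₁ c₂ c₃ κ₀ κh₀ w κ κh) (hc₃ : 0 ≤ c₃) {a b : ℝ}
    (ha : 0 ≤ a) (hab : a ≤ b) (hS : ∀ t ∈ Ioo a b, windowSup Lam z τ w t ≤ 1) : κ a ≤ κ b := by
  have := (hs.gain_ac.on ha hab).le_sub_of_le_deriv (k := 0) hab (by
    filter_upwards [(ae_restrict_iff' measurableSet_Ioi).1 hs.gain_eq] with t ht htI
    refine ⟨_, ht (ha.trans_lt htI.1), ?_⟩
    rw [rateProp, if_pos (hS t htI)]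
    exact mul_nonneg hc₃ (wnorm_nonneg _ _))
  linarith

/-- Once `μ ≥ 1`, the proportional gain grows at a rate at least proportional to the error. -/
theorem le_gain_sub (hs : IsControlledSolution N z Lam τ μ c₁ c₂ c₃ κ₀ κh₀ w κ κh)
    (hc₂ : 0 ≤ c₂) (hc₃ : 0 ≤ c₃) {M T₀ : ℝ} (hM : 0 < M) (hMle : ∀ y, ‖y‖ ≤ M * wnorm Lam y)
    (hT₀ : 0 ≤ T₀) (hμ : ∀ t, T₀ ≤ t → 1 ≤ μ t) (a b m : ℝ) (ha : T₀ ≤ a) (hab : a ≤ b)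
    (hm : ∀ s ∈ Icc a b, m ≤ ‖w s - z‖) : min c₂ c₃ / M * m * (b - a) ≤ κ b - κ a := by
  refine (hs.gain_ac.on (hT₀.trans ha) hab).le_sub_of_le_deriv hab ?_
  filter_upwards [(ae_restrict_iff' measurableSet_Ioi).1 hs.gain_eq] with t ht htI
  refine ⟨_, ht ((hT₀.trans ha).trans_lt htI.1), ?_⟩
  refine le_trans ?_ (min_mul_le_rateProp hc₂ (hμ t (ha.trans htI.1.le)) (wnorm_nonneg _ _) _)
  have h1 : m ≤ M * wnorm Lam (w t - z) := (hm t (Ioo_subset_Icc_self htI)).trans (hMle _)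
  have h2 : 0 ≤ min c₂ c₃ := le_min hc₂ hc₃
  rw [div_mul_eq_mul_div, div_le_iff₀ hM]
  calc min c₂ c₃ * m ≤ min c₂ c₃ * (M * wnorm Lam (w t - z)) := mul_le_mul_of_nonneg_left h1 h2
    _ = min c₂ c₃ * wnorm Lam (w t - z) * M := by ring

/-- Before `T₀` the gain may decrease, as `μ` may be negative there, but continuity bounds it on
`[0, T₀]`. -/
theorem gain_bddBelow (hs : IsControlledSolution N z Lam τ μ c₁ c₂ c₃ κ₀ κh₀ w κ κh) {T₀ : ℝ}
    (hT₀ : 0 ≤ T₀) (hmono : ∀ a b, T₀ ≤ a → a ≤ b → κ a ≤ κ b) :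
    ∃ K, 0 ≤ K ∧ ∀ t, 0 ≤ t → -K ≤ κ t := by
  obtain ⟨K, hK⟩ := (hs.gain_ac.on le_rfl hT₀).exists_bound
  rw [uIcc_of_le hT₀] at hK
  refine ⟨K, (norm_nonneg _).trans (hK 0 ⟨le_rfl, hT₀⟩), fun t ht => ?_⟩
  rcases le_total t T₀ with h | h
  · exact (abs_le.1 (hK t ⟨ht, h⟩)).1
  · exact (abs_le.1 (hK T₀ ⟨hT₀, le_rfl⟩)).1.trans (hmono _ _ le_rfl h)

/-- If the constant gain stays bounded while the window supremum is eventually at most `1`, the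
error vanishes from some time on: otherwise a nonzero error would keep the window supremum positive
for a long time. -/
theorem eq_target_of_gainh_le (hs : IsControlledSolution N z Lam τ μ c₁ c₂ c₃ κ₀ κh₀ w κ κh)
    (hLam : ∀ p l, 0 < Lam p l) (hτ : Tendsto τ atTop atTop) (hc₁ : 0 < c₁) {T₁ L : ℝ}
    (hT₁ : 0 ≤ T₁) (hS : ∀ t, T₁ ≤ t → windowSup Lam z τ w t ≤ 1) (hL : ∀ t, 0 ≤ t → κh t ≤ L) :
    ∃ T, 0 ≤ T ∧ ∀ t, T ≤ t → w t = z := by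
  have hκ := hs.gainh_mono hc₁.le
  -- Growth at rate `c₁` for a time `Δ` exceeds the available increase `L - κh 0` by `c₁`.
  set Δ := (L - κh 0) / c₁ + 1 with hΔ
  have hΔ1 : 1 ≤ Δ := by
    have : 0 ≤ (L - κh 0) / c₁ := div_nonneg (by linarith [hL 0 le_rfl]) hc₁.le
    linarith
  obtain ⟨T₂, hT₂⟩ := (hτ.eventually_ge_atTop Δ).exists_forall_of_atTop
  refine ⟨max T₁ T₂, hT₁.trans (le_max_left _ _), fun t₀ ht₀ => ?_⟩
  obtain ⟨h1, h2⟩ := max_le_iff.1 ht₀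
  by_contra hne
  -- Since `τ ≥ Δ` here, `t₀` stays in every window up to time `t₀ + Δ`.
  have hinc := hs.le_gainh_sub (a := t₀) (b := t₀ + Δ) (by linarith) (by linarith) fun t ht =>
    ⟨windowSup_pos hLam hs.history ⟨by linarith [hT₂ t (h2.trans ht.1.le), ht.2], ht.1.le⟩ hne,
      hS t (h1.trans ht.1.le)⟩
  have h3 := hL (t₀ + Δ) (by linarith)
  have h4 := hκ 0 t₀ le_rfl (by linarith)
  have h5 : c₁ * Δ = L - κh 0 + c₁ := by rw [hΔ]; field_simp
  rw [add_sub_cancel_left, h5] at hinc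
  linarith

/-- Every controlled solution reaches the target in finite time. -/
theorem exists_eq_target (hs : IsControlledSolution N z Lam τ μ c₁ c₂ c₃ κ₀ κh₀ w κ κh)
    (hf : BoundedPartials N.f) (hg : BoundedPartials N.g) (hτ : DelayBound N τ)
    (hμ : Tendsto μ atTop atTop) (hLam : ∀ p l, 0 < Lam p l) (hc₁ : 0 < c₁) (hc₂ : 0 < c₂)
    (hc₃ : 0 < c₃) : ∃ T, 0 ≤ T ∧ ∀ t, T ≤ t → w t = z := by
  obtain ⟨A, hA, hdrift⟩ := N.exists_drift_bound hf hg z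
  obtain ⟨h, hh, hwin⟩ := hτ.exists_lower
  obtain ⟨M, hM, hMle⟩ := exists_le_wnorm hLam
  obtain ⟨M', hM', hM'le⟩ := exists_wnorm_le Lam
  have E := hs.errorSystem hτ hA hdrift
    (fun p l => abs_apply_le_norm (fun p => N.residual z p) p l) hh hwin
  have hκh := hs.gainh_mono hc₁.le
  have hκh0 : ∀ t, 0 ≤ t → κh 0 ≤ κh t := fun t ht => hκh 0 t le_rfl ht
  obtain ⟨T₀, hT₀, hμ1⟩ : ∃ T₀, 0 ≤ T₀ ∧ ∀ t, T₀ ≤ t → 1 ≤ μ t := by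
    obtain ⟨T, hT⟩ := (hμ.eventually_ge_atTop 1).exists_forall_of_atTop
    exact ⟨max T 0, le_max_right _ _, fun t ht => hT t ((le_max_left _ _).trans ht)⟩
  have hinc := hs.le_gain_sub hc₂.le hc₃.le hM hMle hT₀ hμ1
  have hκ : ∀ a b, T₀ ≤ a → a ≤ b → κ a ≤ κ b := fun a b ha hab => by
    have := hinc a b 0 ha hab fun s _ => norm_nonneg _
    linarith
  obtain ⟨K₀, hK₀, hκK⟩ := hs.gain_bddBelow hT₀ hκ
  obtain ⟨⟨B, _, hB⟩, hlim⟩ : (∃ B, 1 ≤ B ∧ ∀ t, h ≤ t → ‖w t - z‖ ≤ B) ∧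
      ∀ η, 0 < η → ∃ T, ∀ t, T ≤ t → ‖w t - z‖ ≤ η := by
    rcases tendsto_atTop_or_of_monotoneOn hκ with hlim | ⟨l, hlim, -⟩
    · exact E.tendsto_zero_of_gain_tendsto hκh0 hlim
    · refine E.tendsto_zero_of_gain_cauchy hκh0 hK₀ hκK (c₀ := min c₂ c₃ / M)
        (div_pos (lt_min hc₂ hc₃) hM) (fun a b m ha hab _ hm => hinc a b m ha hab hm) ?_
      intro ε hε
      obtain ⟨T, hT⟩ := Metric.tendsto_atTop.1 hlim (ε / 2) (half_pos hε)
      refine ⟨T, fun a b ha hab => ?_⟩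
      have h1 := abs_lt.1 (hT a ha)
      have h2 := abs_lt.1 (hT b (ha.trans hab))
      linarith
  obtain ⟨T₁, hT₁, hS⟩ : ∃ T₁, 0 ≤ T₁ ∧ ∀ t, T₁ ≤ t → windowSup Lam z τ w t ≤ 1 := by
    obtain ⟨T, hT⟩ := hlim (1 / M') (by positivity)
    obtain ⟨T', hT'⟩ := (hτ.tendsto_sub.eventually_ge_atTop T).exists_forall_of_atTop
    refine ⟨max T' 0, le_max_right _ _, fun t ht => windowSup_le zero_le_one fun s hs => ?_⟩
    have h1 := hT s ((hT' t ((le_max_left _ _).trans ht)).trans hs.1)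
    calc wnorm Lam (w s - z) ≤ M' * ‖w s - z‖ := hM'le _
      _ ≤ M' * (1 / M') := mul_le_mul_of_nonneg_left h1 hM'.le
      _ = 1 := by field_simp
  rcases tendsto_atTop_or_of_monotoneOn hκh with htop | ⟨L, -, hL⟩
  · obtain ⟨T, hT, hzero⟩ := E.eq_zero_of_gainh_tendsto hK₀ hκK hB htop
    exact ⟨T, hT, fun t ht => sub_eq_zero.1 (hzero t ht)⟩
  · exact hs.eq_target_of_gainh_le hLam hτ.tendsto hc₁ hT₁ hS hL

/-! ### Lyapunov stability -/

/-- Suppose the initial constant gain dominates the residual at the target, the history is at most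
`δ`, and the error is at most `ε` on `[0, T]`, where `ε` is so small that the window supremum does
not exceed `1`. Then the growth of the constant gain limits the error at time `T`. -/
theorem norm_sub_le_of_gainh (hs : IsControlledSolution N z Lam τ μ c₁ c₂ c₃ κ₀ κh₀ w κ κh)
    {A h : ℝ} (E : ErrorSystem (fun t => w t - z) τ κ κh A κh₀ h) (hLam : ∀ p l, 0 < Lam p l)
    (hc₁ : 0 < c₁) (hc₃ : 0 ≤ c₃) (hτ : DelayBound N τ) {M ε δ T : ℝ} (hM : 0 ≤ M)
    (hMle : ∀ y, wnorm Lam y ≤ M * ‖y‖) (hMε : M * ε ≤ 1) (hδ : 0 ≤ δ)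
    (hhist : ∀ s, s ≤ 0 → ‖w s - z‖ ≤ δ) (hδε : δ ≤ ε) (hT : 0 ≤ T)
    (hbd : ∀ s ∈ Icc 0 T, ‖w s - z‖ ≤ ε) :
    ‖w T - z‖ ≤ δ + ((A + |κ₀|) * ε) ^ 2 / (2 * c₁) := by
  have hle : ∀ s, s ≤ T → ‖w s - z‖ ≤ ε := fun s hsT => by
    rcases le_total s 0 with h | h
    · exact (hhist s h).trans hδε
    · exact hbd s ⟨h, hsT⟩
  have hS : ∀ t, t ≤ T → windowSup Lam z τ w t ≤ 1 := fun t ht =>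
    windowSup_le zero_le_one fun s hs => (hMle _).trans
      ((mul_le_mul_of_nonneg_left (hle s (hs.2.trans ht)) hM).trans hMε)
  have hκ : ∀ t, 0 ≤ t → t ≤ T → -|κ₀| ≤ κ t := fun t ht htT => by
    have := hs.gain_le_of_windowSup_le hc₃ le_rfl ht fun s hs => hS s (hs.2.le.trans htT)
    rw [hs.gain_init] at this
    exact (neg_abs_le _).trans this
  set m := (A + |κ₀|) * ε with hm
  refine norm_le_of_abs_apply_le (by positivity) fun p l => ?_
  have hcont : ContinuousOn (fun t => |(w t - z) p l|) (Icc 0 T) := by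
    have hy := E.cont
    have : Continuous fun t => (w t - z) p l :=
      (continuous_apply l).comp ((continuous_apply p).comp hy)
    exact this.abs.continuousOn
  -- After the last zero `t₀` of this component the window supremum is positive, so `κh` grows at
  -- rate `c₁`.
  obtain ⟨t₀, ht₀, h0, hpos⟩ := hcont.exists_last_le (η := 0) hT
  have hgain : ∀ t ∈ Ioc t₀ T, κh₀ + c₁ * (t - t₀) ≤ κh t := by
    intro t ht
    have h1 := hs.le_gainh_sub ht₀.1 ht.1.le fun s hs' => by
      have hsT : s ≤ T := hs'.2.le.trans ht.2
      refine ⟨windowSup_pos hLam hs.history (s := s)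
        ⟨by linarith [hτ.nonneg p (ht₀.1.trans hs'.1.le)], le_rfl⟩ fun heq => ?_, hS s hsT⟩
      have := hpos s ⟨hs'.1, hsT⟩
      simp [heq] at this
    have h2 := hs.gainh_mono hc₁.le 0 t₀ le_rfl ht₀.1
    rw [hs.gainh_init] at h2
    linarith
  have hstep := ((E.ac p l).on ht₀.1 ht₀.2).abs_le_of_ne_zero (k := m) (c := c₁) ht₀.2
    (fun t ht => abs_pos.1 (hpos t ht)) (by
      filter_upwards [E.rate p l] with t ht htI
      have htpos : 0 < t := ht₀.1.trans_lt htI.1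
      obtain ⟨D, hD, hDR⟩ := ht htpos
      obtain ⟨h1, h2⟩ := hDR ε fun s hs => hle s (hs.2.trans htI.2.le)
      have h3 : A * ε + κh₀ - κh t - κ t * |(w t - z) p l| ≤ m - c₁ * (t - t₀) := by
        have h4 := hgain t ⟨htI.1, htI.2.le⟩
        have h5 : -|κ₀| * |(w t - z) p l| ≤ κ t * |(w t - z) p l| :=
          mul_le_mul_of_nonneg_right (hκ t htpos.le htI.2.le) (abs_nonneg _)
        have h6 : |κ₀| * |(w t - z) p l| ≤ |κ₀| * ε := mul_le_mul_of_nonneg_left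
          ((abs_apply_le_norm _ _ _).trans (hle t htI.2.le)) (abs_nonneg _)
        rw [hm]
        linarith
      exact ⟨D, hD, fun hp => (h1 hp).trans h3, fun hn => (h2 hn).trans h3⟩)
  have hstart : |(w t₀ - z) p l| ≤ δ := by
    rcases h0 with rfl | h0
    · exact (abs_apply_le_norm _ _ _).trans (hhist _ le_rfl)
    · exact h0.trans hδ
  -- The maximum of `m s - c₁ s² / 2` is attained at `s = m / c₁`.
  have hsq : m * (T - t₀) - c₁ * (T - t₀) ^ 2 / 2 ≤ m ^ 2 / (2 * c₁) := by
    rw [le_div_iff₀ (by positivity)]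
    linarith [sq_nonneg (m - c₁ * (T - t₀))]
  linarith

end IsControlledSolution

/-- A continuous function that starts below `ε` and reaches it does so for a first time. -/
theorem exists_first_eq {v : ℝ → ℝ} (hv : Continuous v) {ε t : ℝ} (ht : 0 ≤ t) (h0 : v 0 < ε)
    (hvt : ε ≤ v t) : ∃ T, 0 ≤ T ∧ v T = ε ∧ ∀ s ∈ Icc 0 T, v s ≤ ε := by
  have hcpt : IsCompact (Icc 0 t ∩ v ⁻¹' {ε}) :=
    isCompact_Icc.inter_right (isClosed_singleton.preimage hv)
  obtain ⟨s₀, hs₀, hs₀'⟩ := intermediate_value_Icc ht hv.continuousOn ⟨h0.le, hvt⟩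
  obtain ⟨T, hT, hmin⟩ := hcpt.exists_isLeast ⟨s₀, hs₀, hs₀'⟩
  refine ⟨T, hT.1.1, hT.2, fun s hs => ?_⟩
  by_contra hcon
  obtain ⟨r, hr, hr'⟩ := intermediate_value_Icc hs.1 hv.continuousOn ⟨h0.le, (not_le.1 hcon).le⟩
  have hTr : T ≤ r := hmin ⟨⟨hr.1, hr.2.trans (hs.2.trans hT.1.2)⟩, hr'⟩
  have : s = r := le_antisymm (hs.2.trans hTr) hr.2
  rw [this] at hcon
  exact hcon hr'.le

/-- Lyapunov stability of the target when the initial constant gain dominates the residual. -/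
theorem lyapunov_stable (N : Network n) (hf : BoundedPartials N.f) (hg : BoundedPartials N.g)
    {τ : ℝ → ℝ} (μ : ℝ → ℝ) (hτ : DelayBound N τ) (z : Fin n → Octonion)
    {Lam : Fin n → Fin 8 → ℝ} (hLam : ∀ p l, 0 < Lam p l) {c₁ c₃ : ℝ} (c₂ : ℝ) (hc₁ : 0 < c₁)
    (hc₃ : 0 < c₃) (κ₀ : ℝ) {κh₀ : ℝ} (hres : ∀ p l, |N.residual z p l| ≤ κh₀) {ε : ℝ}
    (hε : 0 < ε) :
    ∃ δ, 0 < δ ∧ ∀ (w : ℝ → Fin n → Octonion) (κ κh : ℝ → ℝ),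
      IsControlledSolution N z Lam τ μ c₁ c₂ c₃ κ₀ κh₀ w κ κh →
        (∀ s, s ≤ 0 → wnorm Lam (w s - z) < δ) → ∀ t, 0 ≤ t → wnorm Lam (w t - z) < ε := by
  obtain ⟨A, hA, hdrift⟩ := N.exists_drift_bound hf hg z
  obtain ⟨h, hh, hwin⟩ := hτ.exists_lower
  obtain ⟨M', hM', hM'le⟩ := exists_le_wnorm hLam
  obtain ⟨M, hM, hMle⟩ := exists_wnorm_le Lam
  set A' := A + |κ₀| with hA'
  have hA'0 : 0 ≤ A' := by positivity
  -- The three bounds return to the weighted norm, keep the window supremum at most `1`, and make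
  -- the quadratic excursion at most `e / 2`. With a history below `e / 4` the total stays below
  -- `e`.
  obtain ⟨e, he, heε, he1, heA⟩ : ∃ e, 0 < e ∧ M * e ≤ ε ∧ M * e ≤ 1 ∧ A' ^ 2 * e ≤ c₁ := by
    refine ⟨min (ε / M) (min (1 / M) (c₁ / (A' ^ 2 + 1))), by positivity, ?_, ?_, ?_⟩
    · rw [mul_comm, ← le_div_iff₀ hM]; exact min_le_left _ _
    · rw [mul_comm, ← le_div_iff₀ hM]; exact (min_le_right _ _).trans (min_le_left _ _)
    · have h1 : min (ε / M) (min (1 / M) (c₁ / (A' ^ 2 + 1))) ≤ c₁ / (A' ^ 2 + 1) :=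
        (min_le_right _ _).trans (min_le_right _ _)
      rw [le_div_iff₀ (by positivity)] at h1
      have h2 : 0 < min (ε / M) (min (1 / M) (c₁ / (A' ^ 2 + 1))) := by positivity
      linarith
  refine ⟨e / 4 / M', by positivity, fun w κ κh hs hhist t ht => ?_⟩
  have E := hs.errorSystem hτ hA hdrift hres hh hwin
  have hhist' : ∀ s, s ≤ 0 → ‖w s - z‖ ≤ e / 4 := fun s hs0 => by
    have h1 := (lt_div_iff₀ hM').1 (hhist s hs0)
    linarith [hM'le (w s - z)]
  have hlt : ‖w t - z‖ < e := by
    by_contra hcon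
    obtain ⟨T, hT, hTe, hbd⟩ := exists_first_eq E.cont.norm ht
      (by linarith [hhist' 0 le_rfl]) (not_lt.1 hcon)
    have hfin := hs.norm_sub_le_of_gainh E hLam hc₁ hc₃.le hτ hM.le hMle he1 (by positivity)
      hhist' (by linarith) hT hbd
    have hsq : (A' * e) ^ 2 / (2 * c₁) ≤ e / 2 := by
      rw [div_le_iff₀ (by positivity)]
      have := mul_le_mul_of_nonneg_right heA he.le
      linarith
    linarith
  calc wnorm Lam (w t - z) ≤ M * ‖w t - z‖ := hMle _
    _ < M * e := mul_lt_mul_of_pos_left hlt hM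
    _ ≤ ε := heε

end OVNN

theorem theorem4 {n : ℕ} (N : OVNN.Network n)
    (hd : ∀ p, 0 < N.d p)
    (hf : OVNN.BoundedPartials N.f) (hg : OVNN.BoundedPartials N.g)
    (τ μ : ℝ → ℝ) (hτ : OVNN.DelayBound N τ) (hμ : OVNN.RateFunction τ μ)
    (z : Fin n → Octonion)
    (Lam : Fin n → Fin 8 → ℝ) (hLam : ∀ p l, 0 < Lam p l)
    (c₁ c₂ c₃ : ℝ) (hc₁ : 0 < c₁) (hc₂ : 0 < c₂) (hc₃ : 0 < c₃)
    (κ₀ κh₀ : ℝ) :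
    -- global convergence to the target in finite time
    (∀ (w : ℝ → Fin n → Octonion) (κ κh : ℝ → ℝ),
      OVNN.IsControlledSolution N z Lam τ μ c₁ c₂ c₃ κ₀ κh₀ w κ κh →
        ∃ T : ℝ, 0 ≤ T ∧ ∀ t, T ≤ t → w t = z) ∧
    -- Lyapunov stability, if the initial gain makes the target an equilibrium
    ((∀ p l, |N.residual z p l| ≤ κh₀) →
      ∀ ε : ℝ, 0 < ε → ∃ δ : ℝ, 0 < δ ∧
        ∀ (w : ℝ → Fin n → Octonion) (κ κh : ℝ → ℝ),
          OVNN.IsControlledSolution N z Lam τ μ c₁ c₂ c₃ κ₀ κh₀ w κ κh →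
            (∀ s, s ≤ 0 → OVNN.wnorm Lam (w s - z) < δ) →
              ∀ t, 0 ≤ t → OVNN.wnorm Lam (w t - z) < ε) := by
  exact ⟨fun w κ κh hs => hs.exists_eq_target hf hg hτ hμ.tendsto hLam hc₁ hc₂ hc₃,
    fun hres ε hε => OVNN.lyapunov_stable N hf hg μ hτ z hLam c₂ hc₁ hc₃ κ₀ hres hε⟩
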